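/- A colourful point configuration in $\mathbb{R}^d$ is a collection of $d+1$ pairwise disjoint finite sets (colours) $\mathbf{S}_1,\ldots,\mathbf{S}_{d+1}\subset\mathbb{R}^d$. A colourful simplex is the convex hull of a subset $S\subseteq\bigcup_{i=1}^{d+1}\mathbf{S}_i$ with $|S\cap\mathbf{S}_i|=1$ for $i=1,\ldots,d+1$; colourful simplices are counted by their vertex sets $S$. Let $\mu(d)$ denote the minimum number of colourful simplices containing the origin $\mathbf{0}$ over all colourful point configurations in $\mathbb{R}^d$ (not necessarily in general position) satisfying $\mathbf{0}\in\bigcap_{i=1}^{d+1}\operatorname{conv}(\mathbf{S}_i)$ and $|\mathbf{S}_i|=d+1$ for $i=1,\ldots,d+1$. Then $$\mu(d)\ \geq\ \tfrac{1}{2}d^2+\tfrac{7}{2}d-8\qquad\text{for every integer } d\geq 4.$$ -/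

import Mathlib

noncomputable section

/-- A colourful point configuration in `ℝ^d`: `d + 1` finite point sets (the colours). Every point
has one colour, so the colours are pairwise disjoint. No general position is required. -/
structure ColourfulConfiguration (d : ℕ) where
  colour : Fin (d + 1) → Finset (EuclideanSpace ℝ (Fin d))
  pairwise_disjoint : Pairwise fun i j => Disjoint (colour i) (colour j)

namespace ColourfulConfiguration

variable {d : ℕ} (S : ColourfulConfiguration d)

open Classical in
/-- All points of the configuration, the union of the colours. -/
def points : Finset (EuclideanSpace ℝ (Fin d)) := Finset.univ.biUnion S.colour

open Classical in
/-- `T` is the vertex set of a colourful simplex: a subset of the points having exactly one point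
of each colour. -/
def IsColourful (T : Finset (EuclideanSpace ℝ (Fin d))) : Prop :=
  T ⊆ S.points ∧ ∀ i, (T ∩ S.colour i).card = 1

open Classical in
/-- The (vertex sets of the) colourful simplices that contain the origin. -/
def simplicesContainingZero : Finset (Finset (EuclideanSpace ℝ (Fin d))) :=
  S.points.powerset.filter fun T =>
    S.IsColourful T ∧
      (0 : EuclideanSpace ℝ (Fin d)) ∈ convexHull ℝ (T : Set (EuclideanSpace ℝ (Fin d)))

/-- Every colour has `d + 1` points and has the origin in its convex hull. -/
def IsCentred : Prop :=
  ∀ i, (S.colour i).card = d + 1 ∧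
    (0 : EuclideanSpace ℝ (Fin d)) ∈
      convexHull ℝ (S.colour i : Set (EuclideanSpace ℝ (Fin d)))

end ColourfulConfiguration

/-- `μ(d)`: the minimum number of colourful simplices containing the origin, over all colourful
point configurations in `ℝ^d` with `d + 1` points in each colour and with the origin in the convex
hull of each colour. -/
def colourfulMu (d : ℕ) : ℕ :=
  sInf {k : ℕ | ∃ S : ColourfulConfiguration d,
    S.IsCentred ∧ S.simplicesContainingZero.card = k}

end

/-! The proof gives the stronger bound d² + 1, by combining a counting theorem with a parity
construction.

Counting. In an octahedral system, two slices in one colour differ by an octahedral system on one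
colour fewer; if that colour has an isolated vertex, every slice is itself octahedral. Induction on
the number of colours then gives `IsOctahedral.weight_bound`. With an isolated vertex, the bounds
for the nonzero slices add up; without one, the bounds for sums of two slices are averaged over all
pairs. Whenever a colour obstructs this, slicing twice yields m² edges, which is more than enough.
With d + 1 full colours of d + 1 vertices the bound reads (d + 1)(d - 1) + 2 = d² + 1.

Geometry. Perturb the colours so that each positively spans the space, and fix a generic vector q.
Let f φ be the parity of the number of facets of the simplex φ whose cone contains q. Each facet
ignores one colour, so f is octahedral. The parity is even if the simplex misses 0, so edges are
simplices containing 0. Bárány's colourful Carathéodory theorem supplies an edge through every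
vertex. Closedness of the finitely many simplices carries the edges back to the original points. -/

/-! ### Octahedral systems, slices and quadratic lower bounds. -/

namespace OctahedralSystem

variable {V : Type*} {n : ℕ}

/-- An octahedral system on `n` colours, each with vertex set `V`, given by its indicator function:
among the `2 ^ n` ways to choose one of `x i`, `y i` in every colour, evenly many are edges. -/
def IsOctahedral (f : (Fin n → V) → ZMod 2) : Prop :=
  ∀ x y : Fin n → V, ∑ b : Fin n → Bool, f (fun i => if b i then x i else y i) = 0

/-- The edges that contain the vertex `v` of colour `i`. -/
def slice (i : Fin (n + 1)) (f : (Fin (n + 1) → V) → ZMod 2) (v : V) : (Fin n → V) → ZMod 2 :=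
  fun x => f (i.insertNth v x)

/-- The vertex `v` of colour `i` lies in an edge. -/
def Covers (f : (Fin n → V) → ZMod 2) (i : Fin n) (v : V) : Prop :=
  ∃ x, x i = v ∧ f x ≠ 0

open Classical in
/-- The number of edges. -/
noncomputable def weight [Fintype V] (f : (Fin n → V) → ZMod 2) : ℕ :=
  (Finset.univ.filter fun x => f x ≠ 0).card

open Classical in
/-- The colours without isolated vertices. -/
noncomputable def fullColours (f : (Fin n → V) → ZMod 2) : Finset (Fin n) :=
  Finset.univ.filter fun i => ∀ v, Covers f i v

theorem IsOctahedral.add {f g : (Fin n → V) → ZMod 2} (hf : IsOctahedral f)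
    (hg : IsOctahedral g) : IsOctahedral (f + g) := by
  intro x y
  simp only [Pi.add_apply, Finset.sum_add_distrib, hf x y, hg x y, add_zero]

theorem isOctahedral_zero : IsOctahedral (0 : (Fin n → V) → ZMod 2) := by
  intro x y; simp

theorem isOctahedral_sum {ι : Type*} (s : Finset ι) (f : ι → (Fin n → V) → ZMod 2)
    (hf : ∀ i ∈ s, IsOctahedral (f i)) : IsOctahedral (∑ i ∈ s, f i) :=
  Finset.sum_induction f IsOctahedral (fun _ _ => IsOctahedral.add) isOctahedral_zero hf

/-- Flipping the choice made in colour `i` pairs off equal terms, which cancel mod 2. -/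
theorem isOctahedral_of_update_eq {f : (Fin n → V) → ZMod 2} (i : Fin n)
    (h : ∀ x v, f (Function.update x i v) = f x) : IsOctahedral f := by
  intro x y
  refine Finset.sum_involution (fun b _ => Function.update b i (!b i)) ?_ ?_ ?_ ?_
  · intro b _
    have : (fun j => if Function.update b i (!b i) j then x j else y j) =
        Function.update (fun j => if b j then x j else y j) i (if !b i then x i else y i) := by
      funext j
      by_cases hj : j = i
      · subst hj; simp
      · simp [hj]
    rw [this, h]
    exact CharTwo.add_self_eq_zero _
  · intro b _ _ hb
    have := congrFun hb i
    simp at this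
  · intro b _; exact Finset.mem_univ _
  · intro b _; simp

theorem add_eq_zero_iff_eq {f g : (Fin n → V) → ZMod 2} : f + g = 0 ↔ f = g := by
  constructor
  · intro h
    funext x
    have := congrFun h x
    exact CharTwo.add_eq_zero.mp this
  · rintro rfl
    funext x
    exact CharTwo.add_self_eq_zero _

theorem add_add_add_same (f g h : (Fin n → V) → ZMod 2) : f + g + (g + h) = f + h := by
  funext x
  simp only [Pi.add_apply]
  have := CharTwo.add_self_eq_zero (g x)
  linear_combination this

theorem slice_add (i : Fin (n + 1)) (f g : (Fin (n + 1) → V) → ZMod 2) (v : V) :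
    slice i (f + g) v = slice i f v + slice i g v := rfl

/-- This is the octahedral condition with `u` and `v` as the two choices in colour `i`, split
according to that choice. -/
theorem IsOctahedral.slice_add_slice {f : (Fin (n + 1) → V) → ZMod 2} (hf : IsOctahedral f)
    (i : Fin (n + 1)) (u v : V) : IsOctahedral (slice i f u + slice i f v) := by
  intro x y
  have key := hf (i.insertNth u x) (i.insertNth v y)
  rw [← (Fin.insertNthEquiv (fun _ => Bool) i).sum_comp, Fintype.sum_prod_type] at key
  simp only [Fintype.sum_bool] at key
  rw [← key]
  simp only [Pi.add_apply, Finset.sum_add_distrib, slice]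
  congr 1 <;>
  · refine Finset.sum_congr rfl fun b _ => congrArg f ?_
    funext j
    refine Fin.succAboveCases i ?_ (fun k => ?_) j <;> simp [Fin.insertNthEquiv]

theorem IsOctahedral.slice_of_slice_eq_zero {f : (Fin (n + 1) → V) → ZMod 2}
    (hf : IsOctahedral f) {i : Fin (n + 1)} {w : V} (hw : slice i f w = 0) (v : V) :
    IsOctahedral (slice i f v) := by
  have := hf.slice_add_slice i v w
  rwa [hw, add_zero] at this

theorem IsOctahedral.eq_zero_of_isEmpty {f : (Fin 0 → V) → ZMod 2} (hf : IsOctahedral f) :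
    f = 0 := by
  funext x
  have := hf x x
  simp only [ite_self, Finset.sum_const, Finset.card_univ] at this
  simpa using this

theorem slice_ne_zero_iff {f : (Fin (n + 1) → V) → ZMod 2} {i : Fin (n + 1)} {v : V} :
    slice i f v ≠ 0 ↔ Covers f i v := by
  constructor
  · intro h
    obtain ⟨x, hx⟩ := Function.ne_iff.mp h
    exact ⟨i.insertNth v x, by simp, hx⟩
  · rintro ⟨x, rfl, hx⟩ h
    apply hx
    have := congrFun h (i.removeNth x)
    simpa [slice] using this

theorem covers_succAbove_iff {f : (Fin (n + 1) → V) → ZMod 2} {i : Fin (n + 1)} {j : Fin n}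
    {v : V} : Covers f (i.succAbove j) v ↔ ∃ w, Covers (slice i f w) j v := by
  constructor
  · rintro ⟨x, rfl, hx⟩
    exact ⟨x i, i.removeNth x, rfl, by simpa [slice] using hx⟩
  · rintro ⟨w, x, rfl, hx⟩
    exact ⟨i.insertNth w x, by simp, hx⟩

theorem mem_fullColours {f : (Fin n → V) → ZMod 2} {i : Fin n} :
    i ∈ fullColours f ↔ ∀ v, Covers f i v := by
  simp [fullColours]

theorem fullColours_zero [Nonempty V] : fullColours (0 : (Fin n → V) → ZMod 2) = ∅ := by
  ext i
  simp [mem_fullColours, Covers]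

theorem fullColours_card_le (f : (Fin n → V) → ZMod 2) : (fullColours f).card ≤ n := by
  simpa using Finset.card_le_univ (fullColours f)

variable [Fintype V]

theorem weight_pos {f : (Fin n → V) → ZMod 2} (hf : f ≠ 0) : 0 < weight f := by
  obtain ⟨x, hx⟩ := Function.ne_iff.mp hf
  exact Finset.card_pos.mpr ⟨x, by simpa using hx⟩

theorem weight_add_le (f g : (Fin n → V) → ZMod 2) : weight (f + g) ≤ weight f + weight g := by
  classical
  unfold weight
  refine le_trans (Finset.card_le_card ?_) (Finset.card_union_le _ _)
  intro x
  simp only [Finset.mem_filter, Finset.mem_univ, true_and, Finset.mem_union, Pi.add_apply]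
  intro h
  by_contra! h'
  exact h (by rw [h'.1, h'.2, add_zero])

theorem weight_eq_sum_slice (i : Fin (n + 1)) (f : (Fin (n + 1) → V) → ZMod 2) :
    weight f = ∑ v, weight (slice i f v) := by
  classical
  simp only [weight, Finset.card_filter]
  rw [← (Fin.insertNthEquiv (fun _ => V) i).sum_comp, Fintype.sum_prod_type]
  rfl

/-- If some `φ v` vanishes, every `φ u` is octahedral and a single nonzero one is heavy enough;
otherwise each of them contributes at least 1. Minimality is a hypothesis so that the lemma can
serve inside the induction of `IsOctahedral.card_le_weight`. -/
theorem card_le_sum_weight_of_pairwise {n : ℕ}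
    (hmin : ∀ f : (Fin n → V) → ZMod 2, IsOctahedral f → f ≠ 0 → Fintype.card V ≤ weight f)
    (φ : V → (Fin n → V) → ZMod 2) (hφ : ∀ u v, IsOctahedral (φ u + φ v))
    (hne : ∃ u, φ u ≠ 0) : Fintype.card V ≤ ∑ u, weight (φ u) := by
  obtain ⟨u, hu⟩ := hne
  by_cases h : ∃ v, φ v = 0
  · obtain ⟨v, hv⟩ := h
    have ho := hφ u v
    rw [hv, add_zero] at ho
    exact (hmin _ ho hu).trans
      (Finset.single_le_sum (f := fun u => weight (φ u)) (fun _ _ => Nat.zero_le _)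
        (Finset.mem_univ u))
  · push Not at h
    calc Fintype.card V = ∑ _u : V, 1 := by simp
      _ ≤ _ := Finset.sum_le_sum fun u _ => weight_pos (h u)

/-- A nonempty octahedral system has at least as many edges as vertices in one colour. -/
theorem IsOctahedral.card_le_weight : ∀ {n : ℕ} {f : (Fin n → V) → ZMod 2},
    IsOctahedral f → f ≠ 0 → Fintype.card V ≤ weight f
  | 0, f, hf, h0 => absurd hf.eq_zero_of_isEmpty h0
  | n + 1, f, hf, h0 => by
    rw [weight_eq_sum_slice 0]
    refine card_le_sum_weight_of_pairwise (fun f hf h => hf.card_le_weight h) _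
      (fun u v => hf.slice_add_slice 0 u v) ?_
    obtain ⟨x, hx⟩ := Function.ne_iff.mp h0
    exact ⟨x 0, slice_ne_zero_iff.mpr ⟨x, rfl, hx⟩⟩

theorem card_sq_le_sum_weight (F : V → V → (Fin n → V) → ZMod 2)
    (hF : ∀ u v w, IsOctahedral (F u w + F v w)) (hne : ∀ w, ∃ u, F u w ≠ 0) :
    Fintype.card V ^ 2 ≤ ∑ u, ∑ w, weight (F u w) := by
  rw [Finset.sum_comm, sq]
  calc Fintype.card V * Fintype.card V = ∑ _w : V, Fintype.card V := by simp
    _ ≤ _ := Finset.sum_le_sum fun w _ =>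
      card_le_sum_weight_of_pairwise (fun f hf h => hf.card_le_weight h) (fun u => F u w)
        (fun u v => hF u v w) (hne w)

/-- An equivalence relation with at least two classes leaves many pairs unrelated. -/
theorem card_le_card_filter_not_related {R : V → V → Prop} [DecidableRel R]
    (hR : Equivalence R) {u v : V} (huv : ¬ R u v) :
    2 * (Fintype.card V - 1 : ℤ) ≤
      ((Finset.univ : Finset (V × V)).filter fun p => ¬ R p.1 p.2).card := by
  classical
  set A : Finset V := Finset.univ.filter (R u)
  have hu : u ∈ A := by simpa [A] using hR.refl u
  have hv : v ∈ Aᶜ := by simpa [A] using huv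
  have h1 : (1 : ℤ) ≤ A.card := by exact_mod_cast Finset.card_pos.mpr ⟨u, hu⟩
  have h2 : (1 : ℤ) ≤ Aᶜ.card := by exact_mod_cast Finset.card_pos.mpr ⟨v, hv⟩
  have h3 : (A.card : ℤ) + Aᶜ.card = Fintype.card V := by
    exact_mod_cast Finset.card_add_card_compl A
  have hsub : (A ×ˢ Aᶜ) ∪ (Aᶜ ×ˢ A) ⊆
      (Finset.univ : Finset (V × V)).filter fun p => ¬ R p.1 p.2 := by
    rintro ⟨a, b⟩ hab
    simp only [A, Finset.mem_union, Finset.mem_product, Finset.mem_compl, Finset.mem_filter,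
      Finset.mem_univ, true_and] at hab ⊢
    intro hr
    rcases hab with ⟨ha, hb⟩ | ⟨ha, hb⟩
    · exact hb (hR.trans ha hr)
    · exact ha (hR.trans hb (hR.symm hr))
  have hdisj : Disjoint (A ×ˢ Aᶜ) (Aᶜ ×ˢ A) := by
    rw [Finset.disjoint_left]
    rintro ⟨a, b⟩ h h'
    simp only [Finset.mem_product, Finset.mem_compl] at h h'
    exact h'.1 h.1
  have hc := Finset.card_le_card hsub
  rw [Finset.card_union_of_disjoint hdisj, Finset.card_product, Finset.card_product] at hc
  have hc' : (A.card : ℤ) * Aᶜ.card + Aᶜ.card * A.card ≤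
      ((Finset.univ : Finset (V × V)).filter fun p => ¬ R p.1 p.2).card := by exact_mod_cast hc
  nlinarith [mul_nonneg (sub_nonneg.mpr h1) (sub_nonneg.mpr h2)]

end OctahedralSystem

/-! ### The lower bound for the number of edges, by induction on colours. -/

namespace OctahedralSystem

variable {V : Type*} {n : ℕ} [Fintype V]

theorem IsOctahedral.card_sq_le_weight_of_mem_fullColours {f : (Fin (n + 1) → V) → ZMod 2}
    {j : Fin (n + 1)} (hj : j ∈ fullColours f) (h : ∀ w, IsOctahedral (slice j f w)) :
    Fintype.card V ^ 2 ≤ weight f := by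
  rw [weight_eq_sum_slice j, sq]
  calc Fintype.card V * Fintype.card V = ∑ _w : V, Fintype.card V := by simp
    _ ≤ _ := Finset.sum_le_sum fun w _ =>
      (h w).card_le_weight (slice_ne_zero_iff.mpr (mem_fullColours.mp hj w))

theorem fullColours_bound_le_sq {n : ℕ} (hV : 2 ≤ Fintype.card V) (hn : n ≤ Fintype.card V)
    (f : (Fin n → V) → ZMod 2) :
    ((fullColours f).card : ℤ) * (Fintype.card V - 2) + 2 ≤ (Fintype.card V ^ 2 : ℕ) := by
  have h1 : ((fullColours f).card : ℤ) ≤ Fintype.card V := by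
    exact_mod_cast (fullColours_card_le f).trans hn
  have h2 : (2 : ℤ) ≤ Fintype.card V := by exact_mod_cast hV
  push_cast
  nlinarith

/-- The induction step for a system with an isolated vertex of colour `i`. -/
theorem weight_bound_of_slice_eq_zero (hV : 2 ≤ Fintype.card V)
    (ih : ∀ g : (Fin n → V) → ZMod 2, IsOctahedral g → g ≠ 0 →
      ((fullColours g).card : ℤ) * (Fintype.card V - 2) + 2 ≤ weight g)
    {f : (Fin (n + 1) → V) → ZMod 2} (hn : n + 1 ≤ Fintype.card V)
    (hf : IsOctahedral f) (h0 : f ≠ 0) {i : Fin (n + 1)} {w₀ : V} (hw₀ : slice i f w₀ = 0) :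
    ((fullColours f).card : ℤ) * (Fintype.card V - 2) + 2 ≤ weight f := by
  classical
  have hs : ∀ w, IsOctahedral (slice i f w) := fun w => hf.slice_of_slice_eq_zero hw₀ w
  have hi : i ∉ fullColours f := fun h =>
    slice_ne_zero_iff.mpr (mem_fullColours.mp h w₀) hw₀
  -- A full colour of `f` that is full in no slice makes all double slices octahedral, hence forces
  -- m² edges. Otherwise every full colour is counted in some nonzero slice, and the inductive
  -- bounds add up.
  by_cases hex : ∃ j : Fin n, i.succAbove j ∈ fullColours f ∧
      ∀ w, j ∉ fullColours (slice i f w)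
  · refine (fullColours_bound_le_sq hV hn f).trans ?_
    norm_cast
    obtain ⟨j, hj, hjw⟩ := hex
    obtain ⟨k, rfl⟩ : ∃ k, n = k + 1 := ⟨n - 1, by have := j.2; omega⟩
    have hoct : ∀ w y, IsOctahedral (slice j (slice i f w) y) := by
      intro w y
      have := hjw w
      rw [mem_fullColours] at this
      push Not at this
      obtain ⟨z, hz⟩ := this
      exact (hs w).slice_of_slice_eq_zero (not_not.mp (mt slice_ne_zero_iff.mp hz)) y
    rw [weight_eq_sum_slice i]
    simp_rw [weight_eq_sum_slice j]
    refine card_sq_le_sum_weight (fun u w => slice j (slice i f u) w)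
      (fun u v w => (hoct u w).add (hoct v w)) fun w => ?_
    simp_rw [slice_ne_zero_iff]
    exact covers_succAbove_iff.mp (mem_fullColours.mp hj w)
  · push Not at hex
    rw [weight_eq_sum_slice i]
    set W : Finset V := Finset.univ.filter fun w => slice i f w ≠ 0
    have hWne : (1 : ℤ) ≤ W.card := by
      obtain ⟨x, hx⟩ := Function.ne_iff.mp h0
      exact_mod_cast Finset.card_pos.mpr
        ⟨x i, by simpa [W] using slice_ne_zero_iff.mpr ⟨x, rfl, hx⟩⟩
    have hJ : fullColours f ⊆ (W.biUnion fun w => fullColours (slice i f w)).map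
        i.succAboveEmb := by
      intro j hj
      obtain ⟨k, rfl⟩ := Fin.exists_succAbove_eq (fun h : j = i => hi (h ▸ hj))
      obtain ⟨w, hw⟩ := hex k hj
      obtain ⟨x, _, hx⟩ := mem_fullColours.mp hw w₀
      have hwW : w ∈ W := by simpa [W] using Function.ne_iff.mpr ⟨x, hx⟩
      exact Finset.mem_map_of_mem _ (Finset.mem_biUnion.mpr ⟨w, hwW, hw⟩)
    have hcard : ((fullColours f).card : ℤ) ≤ ∑ w ∈ W, ((fullColours (slice i f w)).card : ℤ) := by
      have := (Finset.card_le_card hJ).trans ((Finset.card_map _).le.trans Finset.card_biUnion_le)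
      exact_mod_cast this
    have hsum : ∑ w ∈ W, (((fullColours (slice i f w)).card : ℤ) * (Fintype.card V - 2) + 2) ≤
        ∑ w ∈ W, (weight (slice i f w) : ℤ) :=
      Finset.sum_le_sum fun w hw => ih _ (hs w) (Finset.mem_filter.mp hw).2
    rw [Finset.sum_add_distrib, ← Finset.sum_mul, Finset.sum_const, nsmul_eq_mul] at hsum
    have hle : ∑ w ∈ W, (weight (slice i f w) : ℤ) ≤ ∑ w, (weight (slice i f w) : ℤ) :=
      Finset.sum_le_sum_of_subset_of_nonneg (Finset.subset_univ _) fun _ _ _ => by positivity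
    have hV' : (0 : ℤ) ≤ (Fintype.card V : ℤ) - 2 := by
      have : (2 : ℤ) ≤ Fintype.card V := by exact_mod_cast hV
      linarith
    have := mul_le_mul_of_nonneg_right hcard hV'
    push_cast
    linarith

/-- Every `d u` occurs in 2(m - 1) of the ordered pairs of distinct elements. -/
theorem sum_pairs_le [DecidableEq V] (d : V → ℤ) (c : V → V → ℤ)
    (h : ∀ u v, u ≠ v → c u v ≤ d u + d v) (hc : ∀ u, c u u = 0) :
    ∑ u, ∑ v, c u v ≤ 2 * (Fintype.card V - 1) * ∑ u, d u := by
  have h1 : ∑ u, ∑ v, c u v ≤ ∑ u, ∑ v, ((d u + d v) - if u = v then 2 * d u else 0) := by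
    refine Finset.sum_le_sum fun u _ => Finset.sum_le_sum fun v _ => ?_
    split_ifs with huv
    · subst huv; rw [hc]; linarith
    · simpa using h u v huv
  refine h1.trans (le_of_eq ?_)
  simp only [Finset.sum_sub_distrib, Finset.sum_add_distrib, Finset.sum_ite_eq, Finset.mem_univ,
    if_true, Finset.sum_const, Finset.card_univ, nsmul_eq_mul, ← Finset.mul_sum]
  ring

/-- The induction step for a system without isolated vertices. -/
theorem weight_bound_of_full (hV : 2 ≤ Fintype.card V)
    (ih : ∀ g : (Fin n → V) → ZMod 2, IsOctahedral g → g ≠ 0 →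
      ((fullColours g).card : ℤ) * (Fintype.card V - 2) + 2 ≤ weight g)
    {f : (Fin (n + 1) → V) → ZMod 2} (hn : n + 1 ≤ Fintype.card V)
    (hf : IsOctahedral f) (hfull : ∀ i v, Covers f i v) :
    ((n + 1 : ℕ) : ℤ) * (Fintype.card V - 2) + 2 ≤ weight f := by
  classical
  have : Nonempty V := Fintype.card_pos_iff.mp (by omega)
  have hV' : (2 : ℤ) ≤ Fintype.card V := by exact_mod_cast hV
  set g : V → (Fin n → V) → ZMod 2 := fun u => slice 0 f u with hg
  have hg0 : ∀ u, g u ≠ 0 := fun u => slice_ne_zero_iff.mpr (hfull 0 u)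
  have hgg : ∀ u v, IsOctahedral (g u + g v) := fun u v => hf.slice_add_slice 0 u v
  by_cases hsq : Fintype.card V ^ 2 ≤ weight f
  · have hn' : ((n + 1 : ℕ) : ℤ) ≤ Fintype.card V := by exact_mod_cast hn
    have hsq' : (Fintype.card V : ℤ) ^ 2 ≤ weight f := by exact_mod_cast hsq
    nlinarith
  have hpairs : ∀ j : Fin n, 2 * (Fintype.card V - 1 : ℤ) ≤
      ((Finset.univ : Finset (V × V)).filter fun p => j ∈ fullColours (g p.1 + g p.2)).card := by
    intro j
    obtain ⟨k, rfl⟩ : ∃ k, n = k + 1 := ⟨n - 1, by have := j.2; omega⟩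
    -- As long as there are fewer than m² edges, `R u v` holds exactly when `j` is not full in `g u
    -- + g v`. Being an equivalence relation with at least two classes, it fails for at least 2(m -
    -- 1) ordered pairs.
    set R : V → V → Prop := fun u v => ∀ w, IsOctahedral (slice j (g u + g v) w) with hR
    have hself : ∀ u, g u + g u = 0 := fun u => add_eq_zero_iff_eq.mpr rfl
    have hReq : Equivalence R := by
      refine ⟨fun u w => ?_, fun {u v} h w => ?_, fun {u v x} h h' w => ?_⟩
      · rw [hself]; exact isOctahedral_zero
      · rw [add_comm]; exact h w
      · have := (h w).add (h' w)
        rwa [← slice_add, add_add_add_same] at this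
    have hRnot : ∀ u v, R u v → j ∉ fullColours (g u + g v) := by
      intro u v h hj
      rcases eq_or_ne u v with rfl | huv
      · rw [hself, fullColours_zero] at hj
        simp at hj
      · apply hsq
        refine (IsOctahedral.card_sq_le_weight_of_mem_fullColours hj h).trans
          ((weight_add_le _ _).trans ?_)
        rw [weight_eq_sum_slice 0 f, ← Finset.sum_pair (f := fun u => weight (g u)) huv]
        exact Finset.sum_le_sum_of_subset (Finset.subset_univ _)
    have hnotR : ∀ u v, ¬ R u v → j ∈ fullColours (g u + g v) := by
      intro u v h
      rw [mem_fullColours]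
      by_contra hj
      push Not at hj
      obtain ⟨w, hw⟩ := hj
      exact h fun y => (hgg u v).slice_of_slice_eq_zero (not_not.mp (mt slice_ne_zero_iff.mp hw)) y
    by_cases htot : ∀ u v, R u v
    · refine absurd ?_ hsq
      rw [weight_eq_sum_slice 0]
      simp_rw [weight_eq_sum_slice j]
      refine card_sq_le_sum_weight (fun u w => slice j (g u) w) (fun u v w => htot u v w)
        fun w => ?_
      simp_rw [slice_ne_zero_iff]
      exact covers_succAbove_iff.mp (hfull ((0 : Fin (k + 2)).succAbove j) w)
    · push Not at htot
      obtain ⟨u, v, huv⟩ := htot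
      refine (card_le_card_filter_not_related hReq huv).trans ?_
      exact_mod_cast Finset.card_le_card fun p hp => by
        simp only [Finset.mem_filter, Finset.mem_univ, true_and] at hp ⊢
        exact hnotR _ _ hp
  have hd : ∀ u v, u ≠ v → (if u = v then 0 else
      ((fullColours (g u + g v)).card : ℤ) * (Fintype.card V - 2) + 2) ≤
      (weight (g u) : ℤ) + weight (g v) := by
    intro u v huv
    rw [if_neg huv]
    -- Equal slices escape the inductive bound, but both are nonempty, which supplies the constant
    -- 2.
    by_cases h0 : g u + g v = 0
    · have h1 := weight_pos (hg0 u)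
      have h2 := weight_pos (hg0 v)
      rw [h0, fullColours_zero]
      simp
      omega
    · refine (ih _ (hgg u v) h0).trans ?_
      exact_mod_cast weight_add_le _ _
  have hsum := sum_pairs_le (fun u => (weight (g u) : ℤ)) _ hd (by simp)
  have hc1 : ∑ u, ∑ v, (if u = v then (0 : ℤ) else
      ((fullColours (g u + g v)).card : ℤ) * (Fintype.card V - 2) + 2) =
      (∑ u, ∑ v, ((fullColours (g u + g v)).card : ℤ)) * (Fintype.card V - 2) +
        2 * (Fintype.card V * (Fintype.card V - 1)) := by
    have : ∀ u v, (if u = v then (0 : ℤ) else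
      ((fullColours (g u + g v)).card : ℤ) * (Fintype.card V - 2) + 2) =
      ((fullColours (g u + g v)).card : ℤ) * (Fintype.card V - 2) + (2 - if u = v then 2 else 0) := by
      intro u v
      split_ifs with h
      · subst h
        rw [add_eq_zero_iff_eq.mpr rfl, fullColours_zero]; simp
      · ring
    simp_rw [this, Finset.sum_add_distrib, Finset.sum_sub_distrib, ← Finset.sum_mul]
    simp
    ring
  have hc2 : ∑ u, ∑ v, ((fullColours (g u + g v)).card : ℤ) =
      ∑ j : Fin n, (((Finset.univ : Finset (V × V)).filter
        fun p => j ∈ fullColours (g p.1 + g p.2)).card : ℤ) := by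
    rw [← Fintype.sum_prod_type' (f := fun u v => ((fullColours (g u + g v)).card : ℤ))]
    have : ∀ p : V × V, ((fullColours (g p.1 + g p.2)).card : ℤ) =
        ∑ j : Fin n, if j ∈ fullColours (g p.1 + g p.2) then 1 else 0 := by
      intro p; simp
    simp_rw [this]
    rw [Finset.sum_comm]
    simp
  have hc3 : (n : ℤ) * (2 * (Fintype.card V - 1)) ≤
      ∑ u, ∑ v, ((fullColours (g u + g v)).card : ℤ) := by
    rw [hc2]
    calc (n : ℤ) * (2 * (Fintype.card V - 1)) = ∑ _j : Fin n, 2 * (Fintype.card V - 1 : ℤ) := by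
          simp
      _ ≤ _ := Finset.sum_le_sum fun j _ => hpairs j
  have hw : (weight f : ℤ) = ∑ u, (weight (g u) : ℤ) := by
    rw [weight_eq_sum_slice 0]; push_cast; rfl
  rw [hc1, ← hw] at hsum
  have h4 := mul_le_mul_of_nonneg_right hc3 (by linarith : (0 : ℤ) ≤ (Fintype.card V : ℤ) - 2)
  -- After division by 2(m - 1) this is the claim, since n(m - 2) + m = (n + 1)(m - 2) + 2.
  have h5 : (2 * (Fintype.card V - 1) : ℤ) * (n * (Fintype.card V - 2) + Fintype.card V) ≤
      2 * (Fintype.card V - 1) * weight f := by linarith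
  have h6 := le_of_mul_le_mul_left h5 (by linarith)
  push_cast
  linarith

/-- A nonempty octahedral system on at most `m` colours, all with `m` vertices, has at least
`k (m - 2) + 2` edges, where `k` is the number of colours without isolated vertices. -/
theorem IsOctahedral.weight_bound (hV : 2 ≤ Fintype.card V) : ∀ {n : ℕ}
    {f : (Fin n → V) → ZMod 2}, n ≤ Fintype.card V → IsOctahedral f → f ≠ 0 →
      ((fullColours f).card : ℤ) * (Fintype.card V - 2) + 2 ≤ weight f
  | 0, f, _, hf, h0 => absurd hf.eq_zero_of_isEmpty h0
  | n + 1, f, hn, hf, h0 => by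
    have ih : ∀ g : (Fin n → V) → ZMod 2, IsOctahedral g → g ≠ 0 →
        ((fullColours g).card : ℤ) * (Fintype.card V - 2) + 2 ≤ weight g :=
      fun g hg h => hg.weight_bound hV (by omega) h
    by_cases hfull : ∀ i v, Covers f i v
    · have h1 := weight_bound_of_full hV ih hn hf hfull
      have h2 : fullColours f = Finset.univ := by
        ext i; simp [mem_fullColours, hfull i]
      rwa [h2, Finset.card_univ, Fintype.card_fin]
    · push Not at hfull
      obtain ⟨i, w, hw⟩ := hfull
      exact weight_bound_of_slice_eq_zero hV ih hn hf h0
        (not_not.mp (mt slice_ne_zero_iff.mp hw))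

/-- An octahedral system on `n` colours with `n` vertices each and without isolated vertices has at
least `(n - 1) ^ 2 + 1` edges. -/
theorem IsOctahedral.sq_add_one_le_weight {d : ℕ} (hd : 1 ≤ d)
    {f : (Fin (d + 1) → Fin (d + 1)) → ZMod 2} (hf : IsOctahedral f)
    (hfull : ∀ i v, Covers f i v) : d ^ 2 + 1 ≤ weight f := by
  have h0 : f ≠ 0 := by
    obtain ⟨x, _, hx⟩ := hfull 0 0
    exact Function.ne_iff.mpr ⟨x, hx⟩
  have h := hf.weight_bound (by simp; omega) (by simp) h0
  have h2 : fullColours f = Finset.univ := by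
    ext i; simp [mem_fullColours, hfull i]
  rw [h2, Finset.card_univ, Fintype.card_fin] at h
  push_cast at h
  zify
  linarith

end OctahedralSystem

/-! ### Facets of a simplex whose cone contains a generic vector. -/

section ConicalGeometry

variable {E : Type*}

/-- The ratio test of the simplex method. -/
theorem exists_ratio_test {ι : Type*} [Fintype ι] {a c : ι → ℝ} (ha : ∀ i, 0 ≤ a i)
    (hc : ∃ i, 0 < c i) :
    ∃ t : ℝ, ∃ i, 0 ≤ t ∧ 0 < c i ∧ a i - t * c i = 0 ∧ ∀ j, 0 ≤ a j - t * c j := by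
  classical
  obtain ⟨i₁, hi₁⟩ := hc
  obtain ⟨i, hi, hmin⟩ := (Finset.univ.filter fun i => 0 < c i).exists_min_image
    (fun i => a i / c i) ⟨i₁, by simpa using hi₁⟩
  simp only [Finset.mem_filter, Finset.mem_univ, true_and] at hi hmin
  have ht : 0 ≤ a i / c i := div_nonneg (ha i) hi.le
  refine ⟨a i / c i, i, ht, hi, by field_simp; ring, fun j => ?_⟩
  rcases lt_or_ge 0 (c j) with hj | hj
  · have := (le_div_iff₀ hj).mp (hmin j hj)
    linarith
  · have := mul_nonpos_of_nonneg_of_nonpos ht hj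
    linarith [ha j]

theorem zero_mem_convexHull_range [AddCommGroup E] [Module ℝ E] {ι : Type*} [Fintype ι]
    {x : ι → E} {c : ι → ℝ} (hc : ∀ i, 0 ≤ c i) (hne : c ≠ 0) (h : ∑ i, c i • x i = 0) :
    (0 : E) ∈ convexHull ℝ (Set.range x) := by
  obtain ⟨i, hi⟩ := Function.ne_iff.mp hne
  have hs : 0 < ∑ i, c i := Finset.sum_pos' (fun i _ => hc i)
    ⟨i, Finset.mem_univ i, lt_of_le_of_ne (hc i) (Ne.symm hi)⟩
  have := Finset.centerMass_mem_convexHull (R := ℝ) Finset.univ (w := c) (z := x)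
    (s := Set.range x) (fun i _ => hc i) hs (fun i _ => Set.mem_range_self i)
  rwa [Finset.centerMass, h, smul_zero] at this

theorem exists_weights_of_zero_mem_convexHull_range [AddCommGroup E] [Module ℝ E] {ι : Type*}
    [Fintype ι] {x : ι → E} (h : (0 : E) ∈ convexHull ℝ (Set.range x)) :
    ∃ c : ι → ℝ, (∀ i, 0 ≤ c i) ∧ ∑ i, c i = 1 ∧ ∑ i, c i • x i = 0 := by
  classical
  have hsub : convexHull ℝ (Set.range x) ⊆ Fintype.linearCombination ℝ x '' stdSimplex ℝ ι := by
    refine convexHull_min ?_ ((convex_stdSimplex ℝ ι).linear_image _)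
    rintro _ ⟨i, rfl⟩
    exact ⟨Pi.single i 1, single_mem_stdSimplex ℝ i, by simp⟩
  obtain ⟨c, hc, hcx⟩ := hsub h
  exact ⟨c, hc.1, hc.2, by simpa [Fintype.linearCombination_apply] using hcx⟩

/-- `q` is not a linear combination of the `x j` with two of them omitted. -/
def IsGenericFor [AddCommGroup E] [Module ℝ E] {ι : Type*} [Fintype ι] (x : ι → E) (q : E) :
    Prop :=
  ∀ a : ι → ℝ, ∑ j, a j • x j = q → ∀ i j, a i = 0 → a j = 0 → i = j

/-- `q` lies in the convex cone spanned by the `x j` with `j ≠ i`. -/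
def MemConeOmit [AddCommGroup E] [Module ℝ E] {ι : Type*} [Fintype ι] (x : ι → E) (q : E)
    (i : ι) : Prop :=
  ∃ a : ι → ℝ, (∀ j, 0 ≤ a j) ∧ a i = 0 ∧ ∑ j, a j • x j = q

section Facets

variable [AddCommGroup E] [Module ℝ E] {ι : Type*} [Fintype ι] {x : ι → E} {q : E}

/-- If `c j ≠ 0`, subtracting a multiple of `c` from `a` gives a representation of `q` vanishing at
both `i` and `j`. -/
theorem IsGenericFor.eq_zero_of_dependency (hq : IsGenericFor x q) {a : ι → ℝ} {i : ι}
    (hai : a i = 0) (ha : ∑ j, a j • x j = q) {c : ι → ℝ} (hci : c i = 0)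
    (hc : ∑ j, c j • x j = 0) : c = 0 := by
  by_contra hne
  obtain ⟨j, hj⟩ := Function.ne_iff.mp hne
  have hj' : c j ≠ 0 := hj
  have hij := hq (fun k => a k - a j / c j * c k) (by
    simp only [sub_smul, mul_smul, Finset.sum_sub_distrib, ← Finset.smul_sum, hc, ha, smul_zero,
      sub_zero]) i j (by simp [hai, hci]) (by field_simp; ring)
  exact hj' (hij ▸ hci)

/-- The representations of `q` thus form a line in direction `c`. The nonnegative ones form a ray or
a segment on it, and its endpoints correspond to the facets whose cone contains `q`. -/
theorem IsGenericFor.exists_eq_add_smul (hq : IsGenericFor x q) {a a' c : ι → ℝ} {i : ι}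
    (hai : a i = 0) (ha : ∑ j, a j • x j = q) (ha' : ∑ j, a' j • x j = q) (hci : c i = 1)
    (hc : ∑ j, c j • x j = 0) (k : ι) : a' k = a k + a' i * c k := by
  have := congrFun (hq.eq_zero_of_dependency hai ha
    (c := fun k => a' k - a k - a' i * c k) (by simp [hai, hci]) (by
      simp only [sub_smul, mul_smul, Finset.sum_sub_distrib, ← Finset.smul_sum, hc, ha, ha',
        smul_zero, sub_self])) k
  simp only [Pi.zero_apply] at this
  linarith

theorem IsGenericFor.pos_of_ne (hq : IsGenericFor x q) {a : ι → ℝ} {i : ι}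
    (hai : a i = 0) (ha : ∑ j, a j • x j = q) (ha0 : ∀ j, 0 ≤ a j) {j : ι} (hj : j ≠ i) :
    0 < a j :=
  lt_of_le_of_ne (ha0 j) fun h => hj (hq a ha j i h.symm hai)

theorem IsGenericFor.memConeOmit_iff_of_nonneg (hq : IsGenericFor x q) {a c : ι → ℝ} {i : ι}
    (hai : a i = 0) (ha : ∑ j, a j • x j = q) (ha0 : ∀ j, 0 ≤ a j) (hci : c i = 1)
    (hc : ∑ j, c j • x j = 0) (hc0 : ∀ j, 0 ≤ c j) (k : ι) : MemConeOmit x q k ↔ k = i := by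
  constructor
  · rintro ⟨a', ha'0, ha'k, ha'⟩
    by_contra hk
    have h1 := hq.exists_eq_add_smul hai ha ha' hci hc k
    have h2 := hq.pos_of_ne hai ha ha0 hk
    have h3 := mul_nonneg (ha'0 i) (hc0 k)
    linarith
  · rintro rfl
    exact ⟨a, ha0, hai, ha⟩

theorem IsGenericFor.exists_memConeOmit_iff_of_neg (hq : IsGenericFor x q) {a c : ι → ℝ} {i : ι}
    (hai : a i = 0) (ha : ∑ j, a j • x j = q) (ha0 : ∀ j, 0 ≤ a j) (hci : c i = 1)
    (hc : ∑ j, c j • x j = 0) (hneg : ∃ j, c j < 0) :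
    ∃ j ≠ i, ∀ k, MemConeOmit x q k ↔ k = i ∨ k = j := by
  obtain ⟨t, j, ht, hcj, haj, hall⟩ := exists_ratio_test (c := fun j => - c j) ha0 (by
    obtain ⟨j, hj⟩ := hneg; exact ⟨j, by linarith⟩)
  have hji : j ≠ i := by rintro rfl; linarith
  have haj0 := hq.pos_of_ne hai ha ha0 hji
  set b : ι → ℝ := fun k => a k - t * - c k with hb
  have hbq : ∑ k, b k • x k = q := by
    simp only [hb, sub_smul, mul_smul, neg_smul, smul_neg, Finset.sum_sub_distrib,
      Finset.sum_neg_distrib, ← Finset.smul_sum, hc, ha, smul_zero, neg_zero, sub_zero]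
  refine ⟨j, hji, fun k => ⟨?_, ?_⟩⟩
  · rintro ⟨a', ha'0, ha'k, ha'⟩
    by_contra! hk
    have h1 := hq.exists_eq_add_smul hai ha ha' hci hc
    have h2 := hq.pos_of_ne hai ha ha0 hk.1
    have h3 : a' i * c k < 0 := by linarith [h1 k]
    have h4 : c k < 0 := by
      by_contra! h; linarith [mul_nonneg (ha'0 i) h]
    -- `a' j ≥ 0` bounds the parameter above by `t`; `a' k = 0` bounds it below. So `a'` is the
    -- other endpoint `b`, where by genericity only the coefficient at `j` vanishes.
    have h5 : a' i = t := by
      apply le_antisymm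
      · have := ha'0 j
        rw [h1 j] at this
        nlinarith
      · have := hall k
        have h6 := h1 k
        rw [ha'k] at h6
        nlinarith
    refine hk.2 (hq b hbq k j ?_ haj)
    have := h1 k
    rw [ha'k, h5] at this
    simp only [hb]; linarith
  · rintro (rfl | rfl)
    · exact ⟨a, ha0, hai, ha⟩
    · exact ⟨b, hall, haj, hbq⟩

open Classical in
/-- If `q` is generic and `0` is not in the simplex, evenly many facets are hit by the ray
through `q`. -/
theorem IsGenericFor.zero_mem_convexHull [FiniteDimensional ℝ E]
    (hcard : Module.finrank ℝ E < Fintype.card ι) (hq : IsGenericFor x q)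
    (h : ((Finset.univ.filter (MemConeOmit x q)).card : ZMod 2) ≠ 0) :
    (0 : E) ∈ convexHull ℝ (Set.range x) := by
  have hne : (Finset.univ.filter (MemConeOmit x q)).Nonempty := by
    rw [Finset.nonempty_iff_ne_empty]
    intro h'; rw [h'] at h; simp at h
  obtain ⟨i, hi⟩ := hne
  obtain ⟨a, ha0, hai, ha⟩ := (Finset.mem_filter.mp hi).2
  have hdep : ¬ LinearIndependent ℝ x := fun hl => by
    have := hl.fintype_card_le_finrank
    omega
  obtain ⟨c', hc', k, hk⟩ := Fintype.not_linearIndependent_iff.mp hdep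
  have hc'i : c' i ≠ 0 := fun h0 => hk
    (congrFun (hq.eq_zero_of_dependency hai ha h0 hc') k)
  set c : ι → ℝ := fun j => (c' i)⁻¹ * c' j with hcdef
  have hci : c i = 1 := inv_mul_cancel₀ hc'i
  have hc : ∑ j, c j • x j = 0 := by
    simp only [hcdef, mul_smul, ← Finset.smul_sum, hc', smul_zero]
  by_cases hc0 : ∀ j, 0 ≤ c j
  · exact zero_mem_convexHull_range hc0 (fun h0 => by rw [h0] at hci; simp at hci) hc
  · push Not at hc0
    obtain ⟨j, hji, hj⟩ := hq.exists_memConeOmit_iff_of_neg hai ha ha0 hci hc hc0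
    exfalso
    apply h
    have : Finset.univ.filter (MemConeOmit x q) = {i, j} := by
      ext k; simp [hj]
    rw [this, Finset.card_pair hji.symm]
    rfl

-- A nonnegative dependency makes the nonnegative representations of `q` a ray, which has a single
-- endpoint.
open Classical in
theorem IsGenericFor.card_memConeOmit_eq_one (hq : IsGenericFor x q) {b c : ι → ℝ}
    (hb0 : ∀ j, 0 ≤ b j) (hb : ∑ j, b j • x j = q) (hc0 : ∀ j, 0 ≤ c j) (hne : ∃ j, c j ≠ 0)
    (hc : ∑ j, c j • x j = 0) : (Finset.univ.filter (MemConeOmit x q)).card = 1 := by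
  obtain ⟨t, i, -, hci, hbi, hall⟩ := exists_ratio_test hb0 (by
    obtain ⟨j, hj⟩ := hne; exact ⟨j, lt_of_le_of_ne (hc0 j) (Ne.symm hj)⟩ : ∃ j, 0 < c j)
  have := hq.memConeOmit_iff_of_nonneg (a := fun j => b j - t * c j)
    (c := fun j => (c i)⁻¹ * c j) hbi (by
      simp only [sub_smul, mul_smul, Finset.sum_sub_distrib, ← Finset.smul_sum, hc, hb,
        smul_zero, sub_zero]) hall (inv_mul_cancel₀ hci.ne') (by
      simp only [mul_smul, ← Finset.smul_sum, hc, smul_zero])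
    (fun j => mul_nonneg (inv_nonneg.mpr hci.le) (hc0 j))
  rw [Finset.card_eq_one]
  exact ⟨i, by ext k; simp [this]⟩

end Facets

end ConicalGeometry

/-! ### Closed cones, colourful Carathéodory and generic vectors. -/

section ColourfulCaratheodory

variable {E : Type*}

/-- The convex cone spanned by finitely many vectors. -/
def finiteCone [AddCommGroup E] [Module ℝ E] {ι : Type*} [Fintype ι] (s : ι → E) : Set E :=
  {q | ∃ a : ι → ℝ, (∀ i, 0 ≤ a i) ∧ ∑ i, a i • s i = q}

/-- Conical Carathéodory: in a representation of minimal support, a dependency would let the ratio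
test remove one more vector. -/
theorem exists_linearIndependent_representation [AddCommGroup E] [Module ℝ E] {ι : Type*}
    [Fintype ι] {s : ι → E} {q : E} (hq : q ∈ finiteCone s) :
    ∃ a : ι → ℝ, (∀ i, 0 ≤ a i) ∧ ∑ i, a i • s i = q ∧
      LinearIndependent ℝ (fun i : {i // a i ≠ 0} => s i) := by
  classical
  set P : ℕ → Prop := fun k => ∃ a : ι → ℝ, (∀ i, 0 ≤ a i) ∧ ∑ i, a i • s i = q ∧
    (Finset.univ.filter fun i => a i ≠ 0).card = k
  have hP : ∃ k, P k := by
    obtain ⟨a, ha, haq⟩ := hq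
    exact ⟨_, a, ha, haq, rfl⟩
  obtain ⟨a, ha, haq, hk⟩ := Nat.find_spec hP
  refine ⟨a, ha, haq, ?_⟩
  by_contra hdep
  obtain ⟨g, hg, i₀, hi₀⟩ := Fintype.not_linearIndependent_iff.mp hdep
  obtain ⟨c, hc0, hcs, hcpos⟩ : ∃ c : ι → ℝ, (∀ i, a i = 0 → c i = 0) ∧
      ∑ i, c i • s i = 0 ∧ ∃ i, 0 < c i := by
    set c : ι → ℝ := fun i => if h : a i ≠ 0 then g ⟨i, h⟩ else 0 with hc
    have h1 : ∀ i, a i = 0 → c i = 0 := fun i hi => by simp [hc, hi]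
    have h2 : ∑ i, c i • s i = 0 := by
      rw [← hg, ← Finset.sum_filter_of_ne (p := fun i => a i ≠ 0)
        (fun i _ hi h0 => hi (by rw [h1 i h0, zero_smul])),
        ← Finset.sum_subtype_eq_sum_filter]
      rw [Finset.subtype_univ]
      refine Finset.sum_congr rfl fun i _ => ?_
      simp [hc, i.2]
    have h3 : c i₀ ≠ 0 := by simpa [hc, i₀.2] using hi₀
    rcases lt_or_gt_of_ne h3 with h | h
    · exact ⟨fun i => - c i, fun i hi => by simp [h1 i hi], by simp [h2], i₀, by simpa using h⟩
    · exact ⟨c, h1, h2, i₀, h⟩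
  obtain ⟨t, i, -, hci, hai, hall⟩ := exists_ratio_test ha hcpos
  refine Nat.find_min hP (m := (Finset.univ.filter fun j => a j - t * c j ≠ 0).card) ?_
    ⟨fun j => a j - t * c j, hall, ?_, rfl⟩
  · rw [← hk]
    refine Finset.card_lt_card ((Finset.ssubset_iff_of_subset ?_).mpr ⟨i, ?_, ?_⟩)
    · intro j
      simp only [Finset.mem_filter, Finset.mem_univ, true_and]
      intro h h0
      exact h (by rw [h0, hc0 j h0]; ring)
    · simp only [Finset.mem_filter, Finset.mem_univ, true_and]
      intro h0
      exact hci.ne' (hc0 i h0)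
    · simp [hai]
  · simp only [sub_smul, mul_smul, Finset.sum_sub_distrib, ← Finset.smul_sum, hcs, haq,
      smul_zero, sub_zero]

/-- By Carathéodory the cone is a finite union of cones on independent subfamilies, each the image
of an orthant under a closed embedding. -/
theorem isClosed_finiteCone [NormedAddCommGroup E] [InnerProductSpace ℝ E]
    [FiniteDimensional ℝ E] {ι : Type*} [Fintype ι] (s : ι → E) : IsClosed (finiteCone s) := by
  classical
  have : finiteCone s = ⋃ I ∈ {I : Finset ι | LinearIndependent ℝ (fun i : I => s i)},
      Fintype.linearCombination ℝ (fun i : I => s i) '' {a | ∀ i, 0 ≤ a i} := by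
    ext q
    simp only [Set.mem_iUnion, Set.mem_ofPred_eq, exists_prop]
    constructor
    · intro hq
      obtain ⟨a, ha, haq, hli⟩ := exists_linearIndependent_representation hq
      refine ⟨Finset.univ.filter fun i => a i ≠ 0, ?_, fun i => a i, fun i => ha i, ?_⟩
      · have := hli.comp (fun i : (Finset.univ.filter fun i => a i ≠ 0 : Finset ι) =>
          (⟨i, (Finset.mem_filter.mp i.2).2⟩ : {i // a i ≠ 0})) (fun i j h => by
            exact Subtype.ext (congrArg (fun k : {i // a i ≠ 0} => (k : ι)) h))
        exact this
      · rw [Fintype.linearCombination_apply, ← haq]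
        rw [Finset.sum_coe_sort _ (fun i => a i • s i)]
        exact Finset.sum_filter_of_ne fun i _ hi h0 => hi (by rw [h0, zero_smul])
    · rintro ⟨I, -, a, ha, rfl⟩
      refine ⟨fun i => if h : i ∈ I then a ⟨i, h⟩ else 0, fun i => ?_, ?_⟩
      · dsimp only; split_ifs with h
        · exact ha _
        · exact le_rfl
      · rw [Fintype.linearCombination_apply, ← Finset.sum_subset (Finset.subset_univ I)
          (fun i _ hi => by simp [hi]), ← Finset.sum_coe_sort]
        exact Finset.sum_congr rfl fun i _ => by simp
  rw [this]
  refine Set.Finite.isClosed_biUnion (Set.toFinite _) fun I hI => ?_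
  refine (LinearMap.isClosedEmbedding_of_injective ?_).isClosedMap _ ?_
  · exact LinearMap.ker_eq_bot.mpr (linearIndependent_iff_injective_fintypeLinearCombination.mp hI)
  · simp only [Set.ofPred_forall]
    exact isClosed_iInter fun i => isClosed_le continuous_const (continuous_apply i)

theorem inner_nonpos_of_norm_le [NormedAddCommGroup E] [InnerProductSpace ℝ E] {r v : E}
    (h : ∀ t : ℝ, 0 ≤ t → t ≤ 1 → ‖r‖ ≤ ‖r - t • v‖) :
    inner ℝ r v ≤ 0 := by
  by_contra! hpos
  have hv : 0 < ‖v‖ ^ 2 := by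
    have : v ≠ 0 := by rintro rfl; simp at hpos
    positivity
  set t : ℝ := min 1 (inner ℝ r v / ‖v‖ ^ 2)
  have ht0 : 0 < t := lt_min one_pos (div_pos hpos hv)
  have ht1 : t * ‖v‖ ^ 2 ≤ inner ℝ r v := (le_div_iff₀ hv).mp (min_le_right _ _)
  have h1 := h t ht0.le (min_le_left _ _)
  have h2 : ‖r‖ ^ 2 ≤ ‖r - t • v‖ ^ 2 := pow_le_pow_left₀ (norm_nonneg _) h1 2
  rw [norm_sub_sq_real, inner_smul_right, norm_smul, mul_pow, Real.norm_eq_abs, sq_abs] at h2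
  nlinarith [mul_le_mul_of_nonneg_left ht1 ht0.le, mul_pos ht0 hpos]

/-- Bárány's conical version of the colourful Carathéodory theorem, for colours that positively
span the space. -/
theorem exists_mem_finiteCone [NormedAddCommGroup E] [InnerProductSpace ℝ E]
    [FiniteDimensional ℝ E] {ι A : Type*} [Fintype ι] [Finite A] [Nonempty A]
    (hcard : Fintype.card ι = Module.finrank ℝ E) (s : ι → A → E)
    (hs : ∀ i, ∀ r : E, r ≠ 0 → ∃ a, 0 < inner ℝ r (s i a)) (b : E) :
    ∃ φ : ι → A, b ∈ finiteCone fun i => s i (φ i) := by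
  classical
  set U : Set E := ⋃ φ : ι → A, finiteCone fun i => s i (φ i)
  have hU : IsClosed U := isClosed_iUnion_of_finite fun φ => isClosed_finiteCone _
  have hUne : U.Nonempty :=
    ⟨0, Set.mem_iUnion.mpr ⟨fun _ => Classical.arbitrary A, fun _ => 0, fun _ => le_rfl, by simp⟩⟩
  obtain ⟨p, hpU, hp⟩ := hU.exists_infDist_eq_dist hUne b
  have hmin : ∀ w ∈ U, ‖b - p‖ ≤ ‖b - w‖ := by
    intro w hw
    rw [← dist_eq_norm, ← dist_eq_norm, ← hp]
    exact Metric.infDist_le_dist_of_mem hw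
  obtain ⟨φ, hφ⟩ := Set.mem_iUnion.mp hpU
  refine ⟨φ, ?_⟩
  by_contra hb
  set r := b - p with hr
  have hr0 : r ≠ 0 := by
    intro h; rw [hr, sub_eq_zero] at h; exact hb (h ▸ hφ)
  -- `p` is the point of the union of colourful cones nearest to `b`. If colour `i` were not needed
  -- for `p`, its vertex could be exchanged for one on the side of `r`, giving a closer point.
  have hnozero : ∀ a : ι → ℝ, (∀ i, 0 ≤ a i) → ∑ i, a i • s i (φ i) = p → ∀ i, a i ≠ 0 := by
    intro a ha hap i hai
    obtain ⟨z, hz⟩ := hs i r hr0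
    refine absurd (inner_nonpos_of_norm_le (r := r) (v := s i z) fun t ht _ => ?_) (not_le.mpr hz)
    have : p + t • s i z ∈ U := by
      refine Set.mem_iUnion.mpr ⟨Function.update φ i z, Function.update a i t, fun j => ?_, ?_⟩
      · by_cases hj : j = i
        · subst hj; simpa using ht
        · simpa [hj] using ha j
      · rw [← hap, ← Finset.add_sum_erase _ _ (Finset.mem_univ i),
          ← Finset.add_sum_erase _ (fun i => a i • s i (φ i)) (Finset.mem_univ i), hai, zero_smul,
          zero_add, add_comm]
        congr 1
        · refine Finset.sum_congr rfl fun j hj => ?_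
          have := Finset.ne_of_mem_erase hj
          simp [this]
        · simp
    have h := hmin _ this
    rwa [← sub_sub, ← hr] at h
  obtain ⟨a, ha, hap⟩ := hφ
  have hapos : ∀ i, 0 < a i := fun i => lt_of_le_of_ne (ha i) (hnozero a ha hap i).symm
  have hmove : ∀ i, ∀ τ : ℝ, - a i ≤ τ → p + τ • s i (φ i) ∈ U := by
    intro i τ hτ
    refine Set.mem_iUnion.mpr ⟨φ, fun j => a j + if j = i then τ else 0, fun j => ?_, ?_⟩
    · dsimp only; split_ifs with h
      · subst h; linarith
      · simpa using ha j
    · simp [add_smul, Finset.sum_add_distrib, hap, ite_smul]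
  -- All coefficients are positive, so `p` can move both ways along each generator, and minimality
  -- forces orthogonality.
  have horth : ∀ i, inner ℝ r (s i (φ i)) = 0 := by
    intro i
    apply le_antisymm
    · refine inner_nonpos_of_norm_le fun t ht _ => ?_
      have := hmin _ (hmove i t (by linarith [ha i]))
      rwa [← sub_sub, ← hr] at this
    · have h1 : inner ℝ r (-(a i • s i (φ i))) ≤ 0 := by
        refine inner_nonpos_of_norm_le fun t ht ht1 => ?_
        have := hmin _ (hmove i (- (t * a i)) (by nlinarith [ha i]))
        rw [← sub_sub, ← hr] at this
        rwa [smul_neg, smul_smul, ← neg_smul]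
      rw [inner_neg_right, inner_smul_right] at h1
      nlinarith [hapos i]
  by_cases hli : LinearIndependent ℝ fun i => s i (φ i)
  · have hspan := hli.span_eq_top_of_card_eq_finrank' hcard
    apply hr0
    have hle : Submodule.span ℝ (Set.range fun i => s i (φ i)) ≤ LinearMap.ker (innerₛₗ ℝ r) := by
      rw [Submodule.span_le]
      rintro _ ⟨i, rfl⟩
      simpa using horth i
    rw [hspan] at hle
    have := hle (Submodule.mem_top (x := r))
    simpa using this
  · obtain ⟨c, hc, i₀, hi₀⟩ := Fintype.not_linearIndependent_iff.mp hli
    obtain ⟨c, hc, hcpos⟩ : ∃ c : ι → ℝ, ∑ i, c i • s i (φ i) = 0 ∧ ∃ i, 0 < c i := by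
      rcases lt_or_gt_of_ne hi₀ with h | h
      · exact ⟨fun i => - c i, by simp [hc], i₀, by simpa using h⟩
      · exact ⟨c, hc, i₀, h⟩
    obtain ⟨t, i, -, -, hai, hall⟩ := exists_ratio_test ha hcpos
    refine hnozero _ hall ?_ i hai
    simp only [sub_smul, mul_smul, Finset.sum_sub_distrib, ← Finset.smul_sum, hc, hap,
      smul_zero, sub_zero]

theorem exists_pos_forall_zero_mem [NormedAddCommGroup E] {ι : Type*} [Finite ι] (C : ι → Set E)
    (hC : ∀ i, IsClosed (C i)) : ∃ δ > 0, ∀ i, ∀ z ∈ C i, ‖z‖ < δ → (0 : E) ∈ C i := by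
  have : ∀ᶠ z in nhds (0 : E), ∀ i, z ∈ C i → (0 : E) ∈ C i := by
    rw [Filter.eventually_all]
    intro i
    by_cases h : (0 : E) ∈ C i
    · exact Filter.Eventually.of_forall fun _ _ => h
    · filter_upwards [(hC i).isOpen_compl.mem_nhds h] with z hz hz'
      exact absurd hz' hz
  obtain ⟨δ, hδ, h⟩ := Metric.eventually_nhds_iff.mp this
  exact ⟨δ, hδ, fun i z hz hzδ => h (by simpa using hzδ) i hz⟩

/-- Omitting two of dim E + 1 vectors leaves a proper span, and a real vector space is not a finite
union of proper subspaces. -/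
theorem exists_generic [AddCommGroup E] [Module ℝ E] {ι Φ : Type*} [Fintype ι] [Finite Φ]
    (hcard : Fintype.card ι = Module.finrank ℝ E + 1) (x : Φ → ι → E) :
    ∃ q, ∀ φ, IsGenericFor (x φ) q := by
  classical
  by_contra! h
  set p : Φ × {ij : ι × ι // ij.1 ≠ ij.2} → Submodule ℝ E := fun k =>
    Submodule.span ℝ ((((Finset.univ.erase k.2.1.1).erase k.2.1.2).image (x k.1) : Finset E) : Set E)
  obtain ⟨⟨φ, ⟨i, j⟩, hij⟩, hk⟩ := Subspace.exists_eq_top_of_iUnion_eq_univ (p := p) (by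
    rw [Set.eq_univ_iff_forall]
    intro q
    obtain ⟨φ, hφ⟩ := h q
    simp only [IsGenericFor] at hφ
    push Not at hφ
    obtain ⟨a, ha, i, j, hi, hj, hij⟩ := hφ
    refine Set.mem_iUnion.mpr ⟨(φ, ⟨(i, j), hij⟩), ?_⟩
    rw [SetLike.mem_coe, ← ha]
    refine Submodule.sum_mem _ fun k _ => ?_
    by_cases h : k = i ∨ k = j
    · rcases h with rfl | rfl <;> simp [hi, hj]
    · push Not at h
      refine Submodule.smul_mem _ _ (Submodule.subset_span ?_)
      rw [Finset.mem_coe]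
      exact Finset.mem_image_of_mem _ (by simp [h.1, h.2]))
  have h1 := finrank_span_finset_le_card (R := ℝ) (((Finset.univ.erase i).erase j).image (x φ))
  have h2 : (((Finset.univ.erase i).erase j).image (x φ)).card ≤ Fintype.card ι - 2 := by
    refine Finset.card_image_le.trans ?_
    rw [Finset.card_erase_of_mem (by simp [Ne.symm hij]), Finset.card_erase_of_mem (by simp),
      Finset.card_univ]
    omega
  have h3 : Set.finrank ℝ ((((Finset.univ.erase i).erase j).image (x φ) : Finset E) : Set E) =
      Module.finrank ℝ E := by
    unfold Set.finrank
    change Module.finrank ℝ (p (φ, ⟨(i, j), hij⟩)) = _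
    rw [hk, finrank_top]
  have h4 : 2 ≤ Fintype.card ι := by
    have := Finset.card_le_univ ({i, j} : Finset ι)
    rwa [Finset.card_pair hij] at this
  omega

end ColourfulCaratheodory

/-! ### The octahedral system of a configuration, and perturbation. -/

section Configurations

variable {E : Type*}

theorem memConeOmit_congr [AddCommGroup E] [Module ℝ E] {ι : Type*} [Fintype ι] {x x' : ι → E}
    {q : E} {i : ι} (h : ∀ j ≠ i, x j = x' j) : MemConeOmit x q i ↔ MemConeOmit x' q i := by
  have key : ∀ a : ι → ℝ, a i = 0 → ∑ j, a j • x j = ∑ j, a j • x' j := fun a ha =>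
    Finset.sum_congr rfl fun j _ => by
      by_cases hj : j = i
      · rw [hj, ha, zero_smul, zero_smul]
      · rw [h j hj]
  exact exists_congr fun a => and_congr_right fun _ => and_congr_right fun ha => by rw [key a ha]

variable [NormedAddCommGroup E] [InnerProductSpace ℝ E] [FiniteDimensional ℝ E]

open OctahedralSystem in
/-- If every colour positively spans the space, some octahedral system without isolated vertices
consists of colourful simplices containing the origin. -/
theorem exists_octahedral_of_positively_spanning {A : Type*} [Finite A] [Nonempty A] {d : ℕ}
    (hd : Module.finrank ℝ E = d) (y : Fin (d + 1) → A → E)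
    (hy : ∀ i, ∀ r : E, r ≠ 0 → ∃ a, 0 < inner ℝ r (y i a)) :
    ∃ f : (Fin (d + 1) → A) → ZMod 2, IsOctahedral f ∧ (∀ i v, Covers f i v) ∧
      ∀ φ, f φ ≠ 0 → (0 : E) ∈ convexHull ℝ (Set.range fun i => y i (φ i)) := by
  classical
  obtain ⟨q, hq⟩ := exists_generic (by simp [hd])
    (fun (φ : Fin (d + 1) → A) (i : Fin (d + 1)) => y i (φ i))
  set f : (Fin (d + 1) → A) → ZMod 2 := ∑ i, fun φ =>
    if MemConeOmit (fun j => y j (φ j)) q i then 1 else 0 with hf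
  have hfφ : ∀ φ, f φ =
      ((Finset.univ.filter (MemConeOmit (fun j => y j (φ j)) q)).card : ZMod 2) := by
    intro φ
    rw [hf, Finset.sum_apply, Finset.sum_boole]
  refine ⟨f, ?_, ?_, ?_⟩
  · refine isOctahedral_sum _ _ fun i _ => isOctahedral_of_update_eq i fun φ v => ?_
    have := memConeOmit_congr (x := fun j => y j (Function.update φ i v j))
      (x' := fun j => y j (φ j)) (q := q) (i := i) (fun j hj => by simp [hj])
    simp only [this]
  · intro i v
    obtain ⟨δ, hδ, hzero⟩ := exists_pos_forall_zero_mem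
      (fun φ : Fin (d + 1) → A => convexHull ℝ (Set.range fun i => y i (φ i)))
      (fun φ => ((Set.finite_range _).isCompact_convexHull ℝ).isClosed)
    -- Writing `q` with coefficient `K` on the prescribed vertex makes the total weight exceed
    -- ‖q‖/δ. The normalised `q` is then a point of the simplex within δ of 0, so the simplex
    -- contains 0.
    set K : ℝ := ‖q‖ / δ + 1
    have hK : 0 < K := by positivity
    obtain ⟨ψ, a, ha, hsum⟩ := exists_mem_finiteCone (by simp [hd])
      (fun k : Fin d => y (i.succAbove k)) (fun k => hy _) (q - K • y i v)
    set φ : Fin (d + 1) → A := i.insertNth v ψ with hφ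
    set b : Fin (d + 1) → ℝ := i.insertNth K a with hb
    have hb0 : ∀ j, 0 ≤ b j := by
      intro j
      refine Fin.succAboveCases i ?_ (fun k => ?_) j
      · simpa [hb] using hK.le
      · simpa [hb] using ha k
    have hbq : ∑ j, b j • y j (φ j) = q := by
      rw [Fin.sum_univ_succAbove _ i]
      simp only [hb, hφ, Fin.insertNth_apply_same, Fin.insertNth_apply_succAbove]
      rw [hsum]
      abel
    have hKσ : K ≤ ∑ j, b j := by
      have : b i = K := by simp [hb]
      rw [← this]
      exact Finset.single_le_sum (fun j _ => hb0 j) (Finset.mem_univ i)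
    have hσ : 0 < ∑ j, b j := hK.trans_le hKσ
    have hmem : (∑ j, b j)⁻¹ • q ∈ convexHull ℝ (Set.range fun i => y i (φ i)) := by
      have := Finset.centerMass_mem_convexHull (R := ℝ) Finset.univ (w := b)
        (z := fun i => y i (φ i)) (s := Set.range fun i => y i (φ i)) (fun i _ => hb0 i) hσ
        (fun i _ => Set.mem_range_self i)
      rwa [Finset.centerMass, hbq] at this
    have hnorm : ‖(∑ j, b j)⁻¹ • q‖ < δ := by
      rw [norm_smul, Real.norm_eq_abs, abs_of_pos (inv_pos.mpr hσ), inv_mul_lt_iff₀ hσ]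
      have h1 : K * δ = ‖q‖ + δ := by simp only [K]; field_simp
      nlinarith
    obtain ⟨c, hc0, hc1, hc⟩ := exists_weights_of_zero_mem_convexHull_range
      (hzero φ _ hmem hnorm)
    have hone := (hq φ).card_memConeOmit_eq_one hb0 hbq hc0 (by
      by_contra! h
      simp [h] at hc1) hc
    refine ⟨φ, by simp [hφ], ?_⟩
    rw [hfφ, hone]
    simp
  · intro φ h
    rw [hfφ] at h
    exact (hq φ).zero_mem_convexHull (by simp [hd]) h

/-- A family of `d + 1` points with the origin in its convex hull can be perturbed so that it
positively spans the space. -/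
theorem exists_near_positively_spanning {d : ℕ} (hd : Module.finrank ℝ E = d)
    (x : Fin (d + 1) → E) (hx : (0 : E) ∈ convexHull ℝ (Set.range x)) {δ : ℝ} (hδ : 0 < δ) :
    ∃ y : Fin (d + 1) → E, (∀ a, ‖x a - y a‖ ≤ δ) ∧
      ∀ r : E, r ≠ 0 → ∃ a, 0 < inner ℝ r (y a) := by
  obtain ⟨l, hl0, hl1, hl⟩ := exists_weights_of_zero_mem_convexHull_range hx
  let e := Module.finBasisOfFinrankEq ℝ E hd
  set ε : ℝ := δ / (2 * (‖∑ a, x a‖ + 1)) with hε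
  have hε0 : 0 < ε := by positivity
  set μ : Fin (d + 1) → ℝ := fun a => l a + ε with hμ
  have hμ0 : ∀ a, 0 < μ a := fun a => add_pos_of_nonneg_of_pos (hl0 a) hε0
  set s : ℝ := ∑ a, μ a with hs
  have hs1 : 1 ≤ s := by
    rw [hs, ← hl1]
    exact Finset.sum_le_sum fun a _ => by simp only [hμ]; linarith
  have hμx : ∑ a, μ a • x a = ε • ∑ a, x a := by
    simp only [hμ, add_smul, Finset.sum_add_distrib, hl, zero_add, Finset.smul_sum]
  set x' : Fin (d + 1) → E := fun a => x a - s⁻¹ • ε • ∑ b, x b with hx'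
  have hμx' : ∑ a, μ a • x' a = 0 := by
    simp only [hx', smul_sub, Finset.sum_sub_distrib, hμx, ← Finset.sum_smul]
    rw [← hs, smul_smul, mul_inv_cancel₀ (by linarith), one_smul, sub_self]
  -- A basis completed by one vector to satisfy the same strictly positive dependency `μ` as `x'`.
  -- Hence every `x' + t • z` satisfies it too, and positively spans once its last d vectors form a
  -- basis, that is, unless -t is an eigenvalue of `A`.
  set z : Fin (d + 1) → E := Fin.cons (-((μ 0)⁻¹ • ∑ k : Fin d, μ k.succ • e k)) e with hz
  have hμz : ∑ a, μ a • z a = 0 := by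
    rw [Fin.sum_univ_succ]
    simp only [hz, Fin.cons_zero, Fin.cons_succ, smul_neg]
    rw [smul_smul, mul_inv_cancel₀ (hμ0 0).ne', one_smul, neg_add_cancel]
  set M : ℝ := ∑ a, ‖z a‖ with hM
  have hM0 : 0 ≤ M := Finset.sum_nonneg fun _ _ => norm_nonneg _
  let A : Module.End ℝ E := e.constr ℝ fun k => x' k.succ
  have hη : 0 < δ / (2 * (M + 1)) := by positivity
  obtain ⟨t, ⟨ht0, htη⟩, htF⟩ := (Set.Ioo_infinite hη).exists_notMem_finite
    ((Module.End.finite_hasEigenvalue A).preimage (f := fun t : ℝ => -t) neg_injective.injOn)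
  refine ⟨fun a => x' a + t • z a, fun a => ?_, fun r hr => ?_⟩
  · have h1 : x a - (x' a + t • z a) = s⁻¹ • ε • ∑ b, x b - t • z a := by
      simp only [hx']; abel
    have h2 : ‖s⁻¹ • ε • ∑ b, x b‖ ≤ δ / 2 := by
      rw [norm_smul, norm_smul, Real.norm_of_nonneg (by positivity), Real.norm_of_nonneg hε0.le]
      have h3 : ε * ‖∑ b, x b‖ ≤ δ / 2 := by
        rw [hε, div_mul_eq_mul_div, div_le_div_iff₀ (by positivity) (by positivity)]
        nlinarith [norm_nonneg (∑ b, x b)]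
      exact (mul_le_of_le_one_left (by positivity) (inv_le_one_of_one_le₀ hs1)).trans h3
    have h4 : ‖t • z a‖ ≤ δ / 2 := by
      rw [norm_smul, Real.norm_of_nonneg ht0.le]
      have h5 : ‖z a‖ ≤ M :=
        Finset.single_le_sum (f := fun a => ‖z a‖) (fun _ _ => norm_nonneg _) (Finset.mem_univ a)
      rw [lt_div_iff₀ (by positivity)] at htη
      nlinarith [mul_le_mul_of_nonneg_left h5 ht0.le]
    rw [h1]
    linarith [norm_sub_le (s⁻¹ • ε • ∑ b, x b) (t • z a)]
  · by_contra! hle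
    have hsum : ∑ a, μ a * inner ℝ r (x' a + t • z a) = 0 := by
      have : ∑ a, μ a • (x' a + t • z a) = 0 := by
        simp only [smul_add, Finset.sum_add_distrib, hμx', smul_comm _ t, ← Finset.smul_sum, hμz,
          smul_zero, add_zero]
      have h := congrArg (inner ℝ r) this
      simpa only [inner_sum, inner_smul_right, inner_zero_right] using h
    have hzero : ∀ a, inner ℝ r (x' a + t • z a) = 0 := by
      intro a
      have := (Finset.sum_eq_zero_iff_of_nonpos (fun a _ =>
        mul_nonpos_of_nonneg_of_nonpos (hμ0 a).le (hle a))).mp hsum a (Finset.mem_univ a)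
      exact (mul_eq_zero.mp this).resolve_left (hμ0 a).ne'
    set B : Module.End ℝ E := A + t • LinearMap.id with hB
    have hBinj : Function.Injective B := by
      rw [← LinearMap.ker_eq_bot, LinearMap.ker_eq_bot']
      intro v hv
      by_contra hv0
      apply htF
      refine Module.End.hasEigenvalue_of_hasEigenvector (x := v) ⟨?_, hv0⟩
      rw [Module.End.mem_eigenspace_iff]
      simp only [hB, LinearMap.add_apply, LinearMap.smul_apply, LinearMap.id_apply] at hv
      rw [neg_smul]
      exact eq_neg_of_add_eq_zero_left hv
    obtain ⟨w, hw⟩ := LinearMap.injective_iff_surjective.mp hBinj r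
    have hcomp : (innerₛₗ ℝ r).comp B = 0 := by
      refine e.ext fun k => ?_
      have := hzero k.succ
      simpa [hB, A, hz, Module.Basis.constr_basis] using this
    have := LinearMap.congr_fun hcomp w
    rw [LinearMap.comp_apply, hw] at this
    exact hr (by simpa using this)

open OctahedralSystem in
theorem exists_octahedral_of_zero_mem_convexHull {d : ℕ} (hd : Module.finrank ℝ E = d)
    (x : Fin (d + 1) → Fin (d + 1) → E) (hx : ∀ i, (0 : E) ∈ convexHull ℝ (Set.range (x i))) :
    ∃ f : (Fin (d + 1) → Fin (d + 1)) → ZMod 2, IsOctahedral f ∧ (∀ i v, Covers f i v) ∧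
      ∀ φ, f φ ≠ 0 → (0 : E) ∈ convexHull ℝ (Set.range fun i => x i (φ i)) := by
  obtain ⟨δ, hδ, hzero⟩ := exists_pos_forall_zero_mem
    (fun φ : Fin (d + 1) → Fin (d + 1) => convexHull ℝ (Set.range fun i => x i (φ i)))
    (fun φ => ((Set.finite_range _).isCompact_convexHull ℝ).isClosed)
  choose y hyx hy using fun i => exists_near_positively_spanning hd (x i) (hx i) (half_pos hδ)
  obtain ⟨f, hf, hcov, hφ⟩ := exists_octahedral_of_positively_spanning hd y hy
  refine ⟨f, hf, hcov, fun φ h => ?_⟩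
  obtain ⟨c, hc0, hc1, hc⟩ := exists_weights_of_zero_mem_convexHull_range (hφ φ h)
  -- The weights expressing 0 in the perturbed simplex give a point of the original simplex of norm
  -- at most δ/2.
  refine hzero φ (∑ i, c i • x i (φ i)) ?_ ?_
  · exact (convex_convexHull ℝ _).sum_mem (fun i _ => hc0 i) hc1
      fun i _ => subset_convexHull ℝ _ (Set.mem_range_self i)
  · have h1 : ∑ i, c i • x i (φ i) = ∑ i, c i • (x i (φ i) - y i (φ i)) := by
      simp only [smul_sub, Finset.sum_sub_distrib, hc, sub_zero]
    rw [h1]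
    calc ‖∑ i, c i • (x i (φ i) - y i (φ i))‖ ≤ ∑ i, c i * (δ / 2) := by
          refine (norm_sum_le _ _).trans (Finset.sum_le_sum fun i _ => ?_)
          rw [norm_smul, Real.norm_of_nonneg (hc0 i)]
          exact mul_le_mul_of_nonneg_left (hyx i _) (hc0 i)
      _ = δ / 2 := by rw [← Finset.sum_mul, hc1, one_mul]
      _ < δ := half_lt_self hδ

end Configurations

/-! ### From edges to colourful simplices, and the final bound. -/

namespace ColourfulConfiguration

theorem image_inter_colour {d : ℕ} (S : ColourfulConfiguration d)
    [DecidableEq (EuclideanSpace ℝ (Fin d))] {z : Fin (d + 1) → EuclideanSpace ℝ (Fin d)}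
    (hz : ∀ i, z i ∈ S.colour i) (i : Fin (d + 1)) :
    Finset.univ.image z ∩ S.colour i = {z i} := by
  ext p
  simp only [Finset.mem_inter, Finset.mem_image, Finset.mem_univ, true_and, Finset.mem_singleton]
  constructor
  · rintro ⟨⟨j, rfl⟩, hj⟩
    by_cases h : j = i
    · rw [h]
    · exact absurd hj (Finset.disjoint_left.mp (S.pairwise_disjoint h) (hz j))
  · rintro rfl
    exact ⟨⟨i, rfl⟩, hz i⟩

theorem sq_add_one_le_card_simplicesContainingZero {d : ℕ} (hd : 1 ≤ d)
    (S : ColourfulConfiguration d) (hS : S.IsCentred) :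
    d ^ 2 + 1 ≤ S.simplicesContainingZero.card := by
  classical
  let eq : ∀ i, S.colour i ≃ Fin (d + 1) := fun i => Finset.equivFinOfCardEq (hS i).1
  set x : Fin (d + 1) → Fin (d + 1) → EuclideanSpace ℝ (Fin d) := fun i a => (eq i).symm a with hxd
  have hmem : ∀ i a, x i a ∈ S.colour i := fun i a => ((eq i).symm a).2
  have hinj : ∀ i, Function.Injective (x i) := fun i =>
    Subtype.val_injective.comp (eq i).symm.injective
  have hrange : ∀ i, Set.range (x i) = S.colour i := by
    intro i
    ext p
    constructor
    · rintro ⟨a, rfl⟩; exact hmem i a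
    · intro hp; exact ⟨eq i ⟨p, hp⟩, by simp [hxd]⟩
  obtain ⟨f, hf, hcov, hφ⟩ := exists_octahedral_of_zero_mem_convexHull (by simp) x
    (fun i => by rw [hrange]; exact (hS i).2)
  refine (hf.sq_add_one_le_weight hd hcov).trans ?_
  refine Finset.card_le_card_of_injOn (fun φ => Finset.univ.image fun i => x i (φ i)) ?_ ?_
  · intro φ h
    have h0 := hφ φ (Finset.mem_filter.mp h).2
    have hsub : (Finset.univ.image fun i => x i (φ i)) ⊆ S.points := by
      intro p hp
      obtain ⟨i, -, rfl⟩ := Finset.mem_image.mp hp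
      exact Finset.mem_biUnion.mpr ⟨i, Finset.mem_univ i, hmem i _⟩
    refine Finset.mem_filter.mpr ⟨Finset.mem_powerset.mpr hsub, ⟨hsub, fun i => ?_⟩, ?_⟩
    · have := congrArg Finset.card
        (S.image_inter_colour (z := fun i => x i (φ i)) (fun i => hmem i _) i)
      rw [Finset.card_singleton] at this
      convert this
    · simpa using h0
  · intro φ _ φ' _ h
    funext i
    apply hinj i
    have h1 := S.image_inter_colour (z := fun i => x i (φ i)) (fun i => hmem i _) i
    have h2 := S.image_inter_colour (z := fun i => x i (φ' i)) (fun i => hmem i _) i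
    simp only at h
    rw [h, h2] at h1
    exact (Finset.singleton_injective h1).symm

/-- Needed because `sInf ∅ = 0`. All points lie on one line, with distinct absolute values and one
negative point per colour. -/
theorem exists_isCentred {d : ℕ} (hd : 1 ≤ d) : ∃ S : ColourfulConfiguration d, S.IsCentred := by
  classical
  obtain ⟨e, rfl⟩ : ∃ e, d = e + 1 := ⟨d - 1, by omega⟩
  set u : EuclideanSpace ℝ (Fin (e + 1)) := EuclideanSpace.single 0 1
  have hu : u ≠ 0 := by simp [u]
  set N : Fin (e + 2) → Fin (e + 2) → ℝ := fun i a => (finProdFinEquiv (i, a) : ℕ) + 1 with hN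
  have hN0 : ∀ i a, 0 < N i a := fun i a => by positivity
  set t : Fin (e + 2) → Fin (e + 2) → ℝ := fun i a => if a = 0 then - N i a else N i a with ht
  have habs : ∀ i a, |t i a| = N i a := by
    intro i a
    simp only [ht]
    split_ifs
    · rw [abs_neg, abs_of_pos (hN0 i a)]
    · rw [abs_of_pos (hN0 i a)]
  have hinj : ∀ i a j b, t i a • u = t j b • u → (i, a) = (j, b) := by
    intro i a j b h
    have h1 : N i a = N j b := by
      rw [← habs, ← habs, smul_left_injective ℝ hu h]
    simp only [hN] at h1
    exact finProdFinEquiv.injective (Fin.ext (by exact_mod_cast add_right_cancel h1))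
  refine ⟨⟨fun i => Finset.univ.image fun a => t i a • u, fun i j hij => ?_⟩, fun i => ⟨?_, ?_⟩⟩
  · refine Finset.disjoint_left.mpr fun p hp hp' => ?_
    obtain ⟨a, -, rfl⟩ := Finset.mem_image.mp hp
    obtain ⟨b, -, hb⟩ := Finset.mem_image.mp hp'
    exact hij (Prod.ext_iff.mp (hinj _ _ _ _ hb)).1.symm
  · rw [Finset.card_image_of_injective _ fun a b h => (Prod.ext_iff.mp (hinj _ _ _ _ h)).2]
    simp
  · rw [Finset.coe_image, Finset.coe_univ, Set.image_univ]
    refine zero_mem_convexHull_range (c := fun a => if a = 0 then N i 1 else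
      if a = 1 then N i 0 else 0) (fun a => ?_) (fun h => ?_) ?_
    · split_ifs
      exacts [(hN0 _ _).le, (hN0 _ _).le, le_rfl]
    · have := congrFun h 0
      simp only [if_true, Pi.zero_apply] at this
      exact (hN0 i 1).ne' this
    · rw [Fin.sum_univ_succ, Fin.sum_univ_succ, Finset.sum_eq_zero]
      · simp [ht, smul_smul, mul_comm (N i 1)]
      · intro k _
        simp [Fin.ext_iff]

end ColourfulConfiguration

theorem sq_add_one_le_colourfulMu {d : ℕ} (hd : 1 ≤ d) : d ^ 2 + 1 ≤ colourfulMu d := by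
  obtain ⟨S, hS⟩ := ColourfulConfiguration.exists_isCentred hd
  refine le_csInf ⟨_, S, hS, rfl⟩ ?_
  rintro k ⟨S, hS, rfl⟩
  exact S.sq_add_one_le_card_simplicesContainingZero hd hS

theorem mainTheorem3 (d : ℕ) (hd : 4 ≤ d) :
    (1 / 2 : ℝ) * (d : ℝ) ^ 2 + (7 / 2 : ℝ) * (d : ℝ) - 8 ≤ (colourfulMu d : ℝ) := by
  have h : ((d ^ 2 + 1 : ℕ) : ℝ) ≤ colourfulMu d :=
    Nat.cast_le.mpr (sq_add_one_le_colourfulMu (by omega))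
  push_cast at h
  -- The difference of the two bounds is (d - 7/2)²/2 + 23/8.
  nlinarith [sq_nonneg ((d : ℝ) - 7 / 2)]
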